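/- Let $n,m\ge 0$ be integers, let $0\le k\le\min\{n,m\}$ be an integer, and let $\tau>0$. Let $\Sigma_0=\Omega\Lambda\Omega^\top$ with $\Omega\in\mathbb{R}^{n\times n}$ orthogonal and $\Lambda=\mathrm{diag}(\lambda_1,\dots,\lambda_n)$, $\lambda_1>\lambda_2>\dots>\lambda_n>0$. For $W\in\mathbb{R}^{n\times m}$ put $$L^1_\tau(W)=\mathcal{B}^2(WW^\top+\tau I_n,\Sigma_0),\qquad \mathcal{B}^2(\Sigma,\Sigma_0)=\mathrm{tr}\Big(\Sigma+\Sigma_0-2\big(\Sigma_0^{1/2}\Sigma\Sigma_0^{1/2}\big)^{1/2}\Big),$$ where $A^{1/2}$ is the positive semidefinite square root. Let $\mathcal{M}(k)$ be the manifold of $n\times m$ real matrices of rank $k$ and $\mathcal{M}(\leqslant k)$ the set of those of rank at most $k$. A point $W\in\mathcal{M}(k)$ is a critical point of $L^1_\tau|_{\mathcal{M}(k)}$ if the differential of this restriction at $W$ vanishes on the tangent space $T_W\mathcal{M}(k)$. For $J\subseteq[n]$ with $|J|=k$, let $\Omega_J\in\mathbb{R}^{n\times k}$ consist of the columns of $\Omega$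 with index in $J$, and let $\bar\Lambda_J\in\mathbb{R}^{k\times k}$ be the diagonal submatrix of $\Lambda$ with rows and columns in $J$. 1. A point $W\in\mathcal{M}(k)$ is a critical point of $L^1_\tau|_{\mathcal{M}(k)}$ if and only if $W=\Omega_J(\bar\Lambda_J-\tau I_k)^{1/2}V^\top$ for some $J\subseteq[n]$ with $|J|=k$ and $\tau\le\lambda_j$ for all $j\in J$, and some $V\in\mathbb{R}^{m\times k}$ with $V^\top V=I_k$. 2. For every such $J$ and $V$, $\;L^1_\tau\big(\Omega_J(\bar\Lambda_J-\tau I_k)^{1/2}V^\top\big)=\sum_{j\notin J}(\sqrt{\lambda_j}-\sqrt{\tau})^2$. 3. If $\tau\le\lambda_i$ for all $i\le k$, then the minimum of $L^1_\tau$ over $\mathcal{M}(\leqslant k)$ exists, equals $\sum_{j>k}(\sqrt{\lambda_j}-\sqrt\tau)^2$, and is attained at $W\in\mathcal{M}(\leqslant k)$ exactly when $W=\Omega_{[k]}(\bar\Lambda_{[k]}-\tau I_k)^{1/2}V^\top$ for some $V\in\mathbb{R}^{m\times k}$ with $V^\top V=I_k$. 4. If $\tau<\lambda_i$ for all $i\le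 k$, then moreover the infimum of $L^1_\tau$ over $\mathcal{M}(k)$ is attained, and $\min_{\mathcal{M}(k)}L^1_\tau=\min_{\mathcal{M}(\leqslant k)}L^1_\tau$. -/

import Mathlib

open scoped Matrix

noncomputable section

namespace BuresWasserstein

section Criticality

open scoped ContDiff

variable {E : Type*} [NormedAddCommGroup E] [NormedSpace ℝ E]

/-- Tangent vectors at `x` to a subset `M` of a normed space (an embedded submanifold in all
uses): velocities at time `0` of smooth curves `(-ε, ε) → M` passing through `x` at time `0`. -/
def tangentVectors (M : Set E) (x : E) : Set E :=
  {v | ∃ (γ : ℝ → E) (ε : ℝ), 0 < ε ∧ ContDiffOn ℝ ∞ γ (Set.Ioo (-ε) ε) ∧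
    (∀ t ∈ Set.Ioo (-ε) ε, γ t ∈ M) ∧ γ 0 = x ∧ HasDerivAt γ v 0}

/-- `x ∈ M` is a critical point of the restriction `f|_M` : the restriction is differentiable
at `x` (that is, `f y = f x + f' (y - x) + o(‖y - x‖)` for `y ∈ M`, with a linear map `f'`), and its
differential, the restriction of `f'` to the tangent space, is the zero function. -/
def IsCriticalPointOn (f : E → ℝ) (M : Set E) (x : E) : Prop :=
  x ∈ M ∧ ∃ f' : E →L[ℝ] ℝ, HasFDerivWithinAt f f' M x ∧ ∀ v ∈ tangentVectors M x, f' v = 0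

end Criticality

/-- The manifold of `n × m` real matrices of rank `k`. -/
def rankEq (n m k : ℕ) : Set (Matrix (Fin n) (Fin m) ℝ) := {W | W.rank = k}

/-- The set of `n × m` real matrices of rank at most `k`. -/
def rankLE (n m k : ℕ) : Set (Matrix (Fin n) (Fin m) ℝ) := {W | W.rank ≤ k}

section Frobenius

open scoped Matrix.Norms.Frobenius

/-- `W` is a critical point of the restriction of `f` to the manifold of rank-`k` matrices, as a
submanifold of the space of `n × m` matrices with the Frobenius norm. -/
def IsCriticalOnRank {n m : ℕ} (f : Matrix (Fin n) (Fin m) ℝ → ℝ) (k : ℕ)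
    (W : Matrix (Fin n) (Fin m) ℝ) : Prop :=
  IsCriticalPointOn f (rankEq n m k) W

end Frobenius

section Loss

open scoped MatrixOrder

/-- The positive semidefinite square root of a positive semidefinite matrix. -/
def psdSqrt {n : ℕ} (A : Matrix (Fin n) (Fin n) ℝ) : Matrix (Fin n) (Fin n) ℝ := CFC.sqrt A

/-- The squared Bures-Wasserstein distance of two positive semidefinite matrices. -/
def bwSq {n : ℕ} (S S₀ : Matrix (Fin n) (Fin n) ℝ) : ℝ :=
  (S + S₀ - (2 : ℝ) • psdSqrt (psdSqrt S₀ * S * psdSqrt S₀)).trace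

/-- The smoothed loss `W ↦ B²(W Wᵀ + τ I, S₀)`. -/
def smoothedLoss {n m : ℕ} (τ : ℝ) (S₀ : Matrix (Fin n) (Fin n) ℝ)
    (W : Matrix (Fin n) (Fin m) ℝ) : ℝ :=
  bwSq (W * Wᵀ + τ • (1 : Matrix (Fin n) (Fin n) ℝ)) S₀

end Loss

/-- The `n × k` submatrix of the columns with index in `J`. -/
def colSub {n k : ℕ} (A : Matrix (Fin n) (Fin n) ℝ) (J : Finset (Fin n)) (hJ : J.card = k) :
    Matrix (Fin n) (Fin k) ℝ :=
  A.submatrix id (J.orderEmbOfFin hJ)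

/-- The `k × k` submatrix of the rows and columns with index in `J`. -/
def principalSub {n k : ℕ} (A : Matrix (Fin n) (Fin n) ℝ) (J : Finset (Fin n)) (hJ : J.card = k) :
    Matrix (Fin k) (Fin k) ℝ :=
  A.submatrix (J.orderEmbOfFin hJ) (J.orderEmbOfFin hJ)

/-- The matrix `Ω_J (Λ̄_J - τ I_k)^{1/2} Vᵀ`; meaningful when `τ ≤ λ_j` for all `j ∈ J`. -/
def candidate {n m k : ℕ} (τ : ℝ) (Ω Λ : Matrix (Fin n) (Fin n) ℝ) (J : Finset (Fin n))
    (hJ : J.card = k) (V : Matrix (Fin m) (Fin k) ℝ) : Matrix (Fin n) (Fin m) ℝ :=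
  colSub Ω J hJ * psdSqrt (principalSub Λ J hJ - τ • (1 : Matrix (Fin k) (Fin k) ℝ)) * Vᵀ

/-- The set of the first `k` of the `n` indices. -/
def firstIndices (n k : ℕ) : Finset (Fin n) := Finset.univ.filter fun i => (i : ℕ) < k

theorem card_firstIndices {n k : ℕ} (h : k ≤ n) : (firstIndices n k).card = k := by
  rw [firstIndices, Fin.card_filter_val_lt, min_eq_right h]

end BuresWasserstein

end

/-!
The differential of `S ↦ B²(S, S₀)` at a positive definite `S` is `H ↦ tr ((1 - T) H)`, where
`T` is the optimal transport map, the positive definite solution of `T S T = S₀`. Hence a point `W`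
of rank `k` is critical exactly when `T W = W` for `S = W Wᵀ + τ I`, and multiplying
`T S T = S₀` by `W` turns this into `S₀ P = P² + τ P` for `P = W Wᵀ`. Then `P` commutes with `S₀`,
whose eigenvalues are simple, so `P` is diagonal in the eigenbasis `Ω` with entries `0` or
`λ_i - τ`. Two matrices with the same `W Wᵀ` differ by an orthogonal factor on the right, which
gives the parametrization by `V`.

The loss is coercive and the set of matrices of rank at most `k` is closed, so a minimizer exists.
It satisfies `T W = W` even if its rank drops below `k`, because the lines `(1 + t Y) W` stay in
that set. An exchange argument on the index sets `J` then identifies it.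
-/

noncomputable section

namespace BuresWasserstein

section Exchange

variable {ι M : Type*} [AddCommGroup M] [LinearOrder M] [IsOrderedAddMonoid M]
  {g : ι → M} {J K : Finset ι}

lemma subset_of_sum_le_sum (hg : ∀ i, 0 ≤ g i) (hcard : J.card ≤ K.card)
    (hlt : ∀ j ∈ J, j ∉ K → ∀ i ∈ K, i ∉ J → g j < g i) (hle : ∑ i ∈ K, g i ≤ ∑ i ∈ J, g i) :
    J ⊆ K := by
  classical
  by_contra hJK
  obtain ⟨j, hj, hjmax⟩ := (J \ K).exists_max_image g (Finset.sdiff_nonempty.2 hJK)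
  obtain ⟨hjJ, hjK⟩ := Finset.mem_sdiff.1 hj
  have hcard_sdiff : (J \ K).card ≤ (K \ J).card := Finset.card_sdiff_le_card_sdiff_iff.2 hcard
  have hne : (K \ J).Nonempty :=
    Finset.card_pos.1 ((Finset.card_pos.2 ⟨j, hj⟩).trans_le hcard_sdiff)
  refine hle.not_gt (Finset.sum_sdiff_lt_sum_sdiff.1 ?_)
  calc ∑ i ∈ J \ K, g i ≤ (J \ K).card • g j := Finset.sum_le_card_nsmul _ _ _ hjmax
    _ ≤ (K \ J).card • g j := nsmul_le_nsmul_left (hg j) hcard_sdiff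
    _ = ∑ _i ∈ K \ J, g j := (Finset.sum_const _).symm
    _ < ∑ i ∈ K \ J, g i := Finset.sum_lt_sum_of_nonempty hne fun i hi =>
        hlt j hjJ hjK i (Finset.mem_sdiff.1 hi).1 (Finset.mem_sdiff.1 hi).2

lemma eq_zero_of_subset_of_sum_le_sum (hg : ∀ i, 0 ≤ g i) (hJK : J ⊆ K)
    (hle : ∑ i ∈ K, g i ≤ ∑ i ∈ J, g i) {i : ι} (hiK : i ∈ K) (hiJ : i ∉ J) : g i = 0 := by
  by_contra h
  exact hle.not_gt
    (Finset.sum_lt_sum_of_subset hJK hiK hiJ ((hg i).lt_of_ne' h) fun j _ _ => hg j)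

end Exchange

section Polar

variable {𝕜 : Type*} [RCLike 𝕜]

lemma exists_linearIsometry_apply_eq {E F : Type*} [AddCommGroup E] [Module 𝕜 E]
    [NormedAddCommGroup F] [InnerProductSpace 𝕜 F] [FiniteDimensional 𝕜 F] {f g : E →ₗ[𝕜] F}
    (h : ∀ x, ‖f x‖ = ‖g x‖) : ∃ u : F →ₗᵢ[𝕜] F, ∀ x, u (f x) = g x := by
  have hker : LinearMap.ker f ≤ LinearMap.ker g := fun x hx => by
    rw [LinearMap.mem_ker, ← norm_eq_zero] at hx ⊢
    rwa [← h]
  let L : LinearMap.range f →ₗ[𝕜] F :=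
    (LinearMap.ker f).liftQ g hker ∘ₗ f.quotKerEquivRange.symm.toLinearMap
  have hL (x : E) : L ⟨f x, x, rfl⟩ = g x := by
    have := f.quotKerEquivRange_symm_apply_image x ⟨x, rfl⟩
    simp only [L, LinearMap.comp_apply, LinearEquiv.coe_coe]
    rw [this, Submodule.mkQ_apply, Submodule.liftQ_apply]
  let u₀ : LinearMap.range f →ₗᵢ[𝕜] F :=
    ⟨L, by rintro ⟨_, x, rfl⟩; exact (congrArg norm (hL x)).trans (h x).symm⟩
  exact ⟨u₀.extend, fun x => (u₀.extend_apply ⟨f x, x, rfl⟩).trans (hL x)⟩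

variable {ι κ κ' : Type*}

lemma toEuclideanLin_symm_mem_unitaryGroup [Fintype κ] [DecidableEq κ]
    (u : EuclideanSpace 𝕜 κ →ₗᵢ[𝕜] EuclideanSpace 𝕜 κ) :
    Matrix.toEuclideanLin.symm u.toLinearMap ∈ Matrix.unitaryGroup κ 𝕜 := by
  rw [Matrix.mem_unitaryGroup_iff', Matrix.star_eq_conjTranspose]
  refine Matrix.toEuclideanLin.injective (LinearMap.ext fun x => ext_inner_left 𝕜 fun y => ?_)
  rw [Matrix.toLpLin_mul_same, Matrix.toEuclideanLin_conjTranspose_eq_adjoint,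
    LinearEquiv.apply_symm_apply, Matrix.toLpLin_one, LinearMap.comp_apply,
    LinearMap.adjoint_inner_right]
  exact u.inner_map_map y x

lemma norm_sq_toEuclideanLin_conjTranspose [Fintype ι] [DecidableEq ι] [Fintype κ]
    (A : Matrix ι κ 𝕜) (x : EuclideanSpace 𝕜 ι) :
    ‖Matrix.toEuclideanLin Aᴴ x‖ ^ 2 =
      RCLike.re (inner 𝕜 x (Matrix.toEuclideanLin (A * Aᴴ) x)) := by
  classical
  rw [← inner_self_eq_norm_sq (𝕜 := 𝕜), Matrix.toLpLin_mul_same,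
    Matrix.toEuclideanLin_conjTranspose_eq_adjoint, LinearMap.adjoint_inner_left,
    LinearMap.comp_apply]

lemma exists_mem_unitaryGroup_eq_mul [Finite ι] [Fintype κ] [DecidableEq κ] {A B : Matrix ι κ 𝕜}
    (h : A * Aᴴ = B * Bᴴ) : ∃ O ∈ Matrix.unitaryGroup κ 𝕜, A = B * O := by
  classical
  have := Fintype.ofFinite ι
  obtain ⟨u, hu⟩ := exists_linearIsometry_apply_eq
    (f := Matrix.toEuclideanLin Bᴴ) (g := Matrix.toEuclideanLin Aᴴ) fun x => by
      rw [← sq_eq_sq₀ (norm_nonneg _) (norm_nonneg _), norm_sq_toEuclideanLin_conjTranspose,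
        norm_sq_toEuclideanLin_conjTranspose, h]
  set O : Matrix κ κ 𝕜 := Matrix.toEuclideanLin.symm u.toLinearMap with hO
  have hOB : O * Bᴴ = Aᴴ := Matrix.toEuclideanLin.injective <| LinearMap.ext fun x => by
    rw [Matrix.toLpLin_mul_same, LinearMap.comp_apply, hO, LinearEquiv.apply_symm_apply]
    exact hu x
  refine ⟨Oᴴ, Unitary.star_mem (toEuclideanLin_symm_mem_unitaryGroup u), ?_⟩
  rw [← Matrix.conjTranspose_conjTranspose A, ← hOB, Matrix.conjTranspose_mul,
    Matrix.conjTranspose_conjTranspose]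

lemma conjTranspose_mul_self_one_submatrix [Fintype κ] [DecidableEq κ] [DecidableEq κ']
    (e : κ' ↪ κ) :
    ((1 : Matrix κ κ 𝕜).submatrix id e)ᴴ * (1 : Matrix κ κ 𝕜).submatrix id e = 1 := by
  rw [Matrix.conjTranspose_submatrix, Matrix.conjTranspose_one,
    ← Matrix.submatrix_mul _ _ _ _ _ Function.bijective_id, Matrix.one_mul,
    Matrix.submatrix_one _ e.injective]

lemma exists_eq_mul_conjTranspose [Finite ι] [Fintype κ] [Fintype κ'] [DecidableEq κ']
    (e : κ' ↪ κ) {A : Matrix ι κ 𝕜} {B : Matrix ι κ' 𝕜} (h : A * Aᴴ = B * Bᴴ) :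
    ∃ V : Matrix κ κ' 𝕜, Vᴴ * V = 1 ∧ A = B * Vᴴ := by
  classical
  set E : Matrix κ κ' 𝕜 := (1 : Matrix κ κ 𝕜).submatrix id e
  have hE : Eᴴ * E = 1 := conjTranspose_mul_self_one_submatrix e
  obtain ⟨O, hO, hA⟩ := exists_mem_unitaryGroup_eq_mul (A := A) (B := B * Eᴴ) <| by
    rw [h, Matrix.conjTranspose_mul, Matrix.conjTranspose_conjTranspose, Matrix.mul_assoc B,
      ← Matrix.mul_assoc Eᴴ, hE, Matrix.one_mul]
  refine ⟨Oᴴ * E, ?_, ?_⟩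
  · rw [Matrix.conjTranspose_mul, Matrix.conjTranspose_conjTranspose, Matrix.mul_assoc,
      ← Matrix.mul_assoc O, ← Matrix.star_eq_conjTranspose O, Matrix.mem_unitaryGroup_iff.1 hO,
      Matrix.one_mul, hE]
  · rw [hA, Matrix.conjTranspose_mul, Matrix.conjTranspose_conjTranspose, Matrix.mul_assoc]

end Polar

section Trace

variable {ι K : Type*} [Fintype ι] [CommRing K]

lemma trace_sub_mul_mul_self_sub (Q R : Matrix ι ι K) :
    ((Q - R) * (Q * Q - R * R)).trace =
      ((Q - R) * Q * (Q - R)).trace + ((Q - R) * R * (Q - R)).trace := by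
  have h : (Q - R) * (Q * Q - R * R) = (Q - R) * Q * (Q - R) + (Q - R) * (Q - R) * R := by
    noncomm_ring
  rw [h, Matrix.trace_add, Matrix.mul_assoc (Q - R) (Q - R) R, Matrix.trace_mul_comm (Q - R)]

variable [DecidableEq ι]

lemma two_mul_trace_sub_trace {Q R : Matrix ι ι K} (hR : IsUnit R) :
    2 * (Q.trace - R.trace) =
      (R⁻¹ * (Q * Q - R * R)).trace - ((Q - R) * R⁻¹ * (Q - R)).trace := by
  rw [Matrix.isUnit_iff_isUnit_det] at hR
  have hfirst : R⁻¹ * (Q * Q - R * R) = R⁻¹ * Q * Q - R := by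
    rw [Matrix.mul_sub, Matrix.nonsing_inv_mul_cancel_left _ _ hR, Matrix.mul_assoc]
  have hsecond : (Q - R) * R⁻¹ * (Q - R) = Q * (R⁻¹ * Q) - Q - Q + R := by
    simp only [Matrix.sub_mul, Matrix.mul_sub, Matrix.mul_nonsing_inv _ hR, Matrix.one_mul,
      Matrix.nonsing_inv_mul_cancel_right _ _ hR, Matrix.mul_assoc]
    abel
  rw [hfirst, hsecond, Matrix.trace_sub, Matrix.trace_add, Matrix.trace_sub, Matrix.trace_sub,
    Matrix.trace_mul_comm Q]
  ring

lemma two_mul_trace_sub_trace_le {Q R : Matrix ι ι ℝ} (hQ : Q.IsHermitian) (hR : R.PosDef) :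
    2 * (Q.trace - R.trace) ≤ (R⁻¹ * (Q * Q - R * R)).trace := by
  have h : 0 ≤ ((Q - R) * R⁻¹ * (Q - R)ᴴ).trace :=
    (hR.inv.posSemidef.mul_mul_conjTranspose_same (Q - R)).trace_nonneg
  rw [(hQ.sub hR.isHermitian).eq] at h
  linarith [two_mul_trace_sub_trace (Q := Q) hR.isUnit]

end Trace

section Frobenius

open scoped Matrix.Norms.Frobenius MatrixOrder

variable {ι κ : Type*} [Fintype ι] [Fintype κ]

lemma frobenius_norm_sq (A : Matrix ι κ ℝ) : ‖A‖ ^ 2 = (A * Aᵀ).trace := by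
  rw [Matrix.frobenius_norm_def, ← Real.sqrt_eq_rpow, Real.sq_sqrt (by positivity)]
  simp [Matrix.trace, Matrix.mul_apply, pow_two]

lemma abs_trace_mul_le (A : Matrix ι κ ℝ) (B : Matrix κ ι ℝ) : |(A * B).trace| ≤ ‖A‖ * ‖B‖ := by
  rw [← Matrix.frobenius_norm_transpose B]
  refine abs_le_of_sq_le_sq ?_ (by positivity)
  rw [mul_pow, frobenius_norm_sq, frobenius_norm_sq]
  simpa [Matrix.trace, Matrix.mul_apply, Fintype.sum_prod_type, pow_two] using
    Finset.sum_mul_sq_le_sq_mul_sq (Finset.univ : Finset (ι × κ)) (fun p => A p.1 p.2)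
      fun p => B p.2 p.1

variable {R : Matrix ι ι ℝ}

lemma exists_norm_sq_le_mul_trace (hR : R.PosDef) :
    ∃ C : ℝ, 0 ≤ C ∧ ∀ D : Matrix ι κ ℝ, ‖D‖ ^ 2 ≤ C * (Dᵀ * R * D).trace := by
  classical
  set B := CFC.sqrt R
  have hBB : B * B = R := CFC.sqrt_mul_sqrt_self R hR.isStrictlyPositive.nonneg
  have hB : B.PosDef := Matrix.IsStrictlyPositive.posDef (hR.isStrictlyPositive.sqrt)
  have hBt : Bᵀ = B := hB.isHermitian
  refine ⟨‖B⁻¹‖ ^ 2, by positivity, fun D => ?_⟩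
  calc ‖D‖ ^ 2 = ‖B⁻¹ * (B * D)‖ ^ 2 := by
        rw [Matrix.nonsing_inv_mul_cancel_left _ _ ((Matrix.isUnit_iff_isUnit_det _).1 hB.isUnit)]
    _ ≤ (‖B⁻¹‖ * ‖B * D‖) ^ 2 := by gcongr; exact Matrix.frobenius_norm_mul _ _
    _ = ‖B⁻¹‖ ^ 2 * (Dᵀ * R * D).trace := by
        rw [mul_pow, frobenius_norm_sq (B * D), Matrix.trace_mul_comm, Matrix.transpose_mul, hBt,
          ← hBB]
        simp only [Matrix.mul_assoc]

lemma exists_norm_sub_le_norm_mul_self_sub (hR : R.PosDef) :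
    ∃ C : ℝ, 0 ≤ C ∧ ∀ Q : Matrix ι ι ℝ, Q.PosSemidef → ‖Q - R‖ ≤ C * ‖Q * Q - R * R‖ := by
  obtain ⟨C, hC, hCD⟩ := exists_norm_sq_le_mul_trace (κ := ι) hR
  refine ⟨C, hC, fun Q hQ => ?_⟩
  have hD : (Q - R)ᵀ = Q - R := hQ.isHermitian.sub hR.isHermitian
  have hQD : 0 ≤ ((Q - R) * Q * (Q - R)).trace := by
    have := (hQ.mul_mul_conjTranspose_same (Q - R)).trace_nonneg
    rwa [Matrix.conjTranspose_eq_transpose_of_trivial, hD] at this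
  have hsq : ‖Q - R‖ * ‖Q - R‖ ≤ ‖Q - R‖ * (C * ‖Q * Q - R * R‖) := by
    calc ‖Q - R‖ * ‖Q - R‖ ≤ C * ((Q - R) * R * (Q - R)).trace := by
          simpa only [pow_two, hD] using hCD (Q - R)
      _ ≤ C * ((Q - R) * (Q * Q - R * R)).trace := by
          gcongr
          rw [trace_sub_mul_mul_self_sub]
          exact le_add_of_nonneg_left hQD
      _ ≤ C * (‖Q - R‖ * ‖Q * Q - R * R‖) := by
          gcongr
          exact (le_abs_self _).trans (abs_trace_mul_le _ _)
      _ = ‖Q - R‖ * (C * ‖Q * Q - R * R‖) := mul_left_comm _ _ _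
  rcases (norm_nonneg (Q - R)).eq_or_lt with h0 | h0
  · rw [← h0]; positivity
  · exact le_of_mul_le_mul_left hsq h0

end Frobenius

section Sqrt

open scoped MatrixOrder

variable {n : ℕ} {A B S S₀ : Matrix (Fin n) (Fin n) ℝ}

lemma posSemidef_psdSqrt (A : Matrix (Fin n) (Fin n) ℝ) : (psdSqrt A).PosSemidef :=
  Matrix.nonneg_iff_posSemidef.1 (CFC.sqrt_nonneg A)

lemma posDef_psdSqrt (hA : A.PosDef) : (psdSqrt A).PosDef :=
  Matrix.IsStrictlyPositive.posDef hA.isStrictlyPositive.sqrt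

lemma psdSqrt_mul_self (hA : A.PosSemidef) : psdSqrt A * psdSqrt A = A :=
  CFC.sqrt_mul_sqrt_self A (Matrix.nonneg_iff_posSemidef.2 hA)

lemma psdSqrt_eq_of_mul_self (hB : B.PosSemidef) (h : B * B = A) : psdSqrt A = B :=
  CFC.sqrt_unique h (Matrix.nonneg_iff_posSemidef.2 hB)

lemma transpose_psdSqrt (A : Matrix (Fin n) (Fin n) ℝ) : (psdSqrt A)ᵀ = psdSqrt A :=
  (posSemidef_psdSqrt A).isHermitian

lemma posSemidef_psdSqrt_mul_mul_psdSqrt (S₀ : Matrix (Fin n) (Fin n) ℝ) (hS : S.PosSemidef) :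
    (psdSqrt S₀ * S * psdSqrt S₀).PosSemidef := by
  simpa only [(posSemidef_psdSqrt S₀).isHermitian.eq] using
    hS.mul_mul_conjTranspose_same (psdSqrt S₀)

lemma posDef_psdSqrt_mul_mul_psdSqrt (hS₀ : S₀.PosDef) (hS : S.PosDef) :
    (psdSqrt S₀ * S * psdSqrt S₀).PosDef := by
  have h := (Matrix.IsUnit.posDef_star_right_conjugate_iff (posDef_psdSqrt hS₀).isUnit).2 hS
  rwa [(posSemidef_psdSqrt S₀).isHermitian.star_eq] at h

end Sqrt

section TransportMap

variable {n : ℕ} {S S₀ : Matrix (Fin n) (Fin n) ℝ}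

/-- The optimal transport map from the centred Gaussian with covariance `S` to the one with
covariance `S₀`: the matrix `T = S₀^{1/2} (S₀^{1/2} S S₀^{1/2})^{-1/2} S₀^{1/2}`, for positive
definite `S` and `S₀`. -/
def transportMap (S S₀ : Matrix (Fin n) (Fin n) ℝ) : Matrix (Fin n) (Fin n) ℝ :=
  psdSqrt S₀ * (psdSqrt (psdSqrt S₀ * S * psdSqrt S₀))⁻¹ * psdSqrt S₀

lemma transpose_transportMap (S S₀ : Matrix (Fin n) (Fin n) ℝ) :
    (transportMap S S₀)ᵀ = transportMap S S₀ := by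
  simp only [transportMap, Matrix.transpose_mul, Matrix.transpose_nonsing_inv, transpose_psdSqrt,
    Matrix.mul_assoc]

lemma transportMap_mul_mul_transportMap (hS₀ : S₀.PosDef) (hS : S.PosDef) :
    transportMap S S₀ * S * transportMap S S₀ = S₀ := by
  have hM := posDef_psdSqrt_mul_mul_psdSqrt hS₀ hS
  set M := psdSqrt S₀ * S * psdSqrt S₀ with hMdef
  have hu := (Matrix.isUnit_iff_isUnit_det _).1 (posDef_psdSqrt hM).isUnit
  calc transportMap S S₀ * S * transportMap S S₀
      = psdSqrt S₀ * ((psdSqrt M)⁻¹ * M * (psdSqrt M)⁻¹) * psdSqrt S₀ := by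
        rw [transportMap, ← hMdef]; nth_rw 4 [hMdef]; simp only [Matrix.mul_assoc]
    _ = psdSqrt S₀ * ((psdSqrt M)⁻¹ * (psdSqrt M * psdSqrt M) * (psdSqrt M)⁻¹) * psdSqrt S₀ := by
        rw [psdSqrt_mul_self hM.posSemidef]
    _ = psdSqrt S₀ * psdSqrt S₀ := by
        rw [Matrix.nonsing_inv_mul_cancel_left _ _ hu, Matrix.mul_nonsing_inv _ hu, Matrix.mul_one]
    _ = S₀ := psdSqrt_mul_self hS₀.posSemidef

end TransportMap

section Derivative

open scoped Matrix.Norms.Frobenius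

lemma hasFDerivWithinAt_of_norm_sub_sub_le {E F : Type*} [NormedAddCommGroup E] [NormedSpace ℝ E]
    [NormedAddCommGroup F] [NormedSpace ℝ F] {f : E → F} {f' : E →L[ℝ] F} {s : Set E} {x : E}
    {C : ℝ} (h : ∀ y ∈ s, ‖f y - f x - f' (y - x)‖ ≤ C * ‖y - x‖ ^ 2) :
    HasFDerivWithinAt f f' s x := by
  refine hasFDerivWithinAt_iff_isLittleO.2 (Asymptotics.IsBigO.trans_isLittleO ?_
    ((Asymptotics.isLittleO_pow_sub_sub x one_lt_two).mono nhdsWithin_le_nhds))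
  refine Asymptotics.IsBigO.of_bound C ?_
  filter_upwards [self_mem_nhdsWithin] with y hy
  simpa using h y hy

variable {ι κ : Type*} [Fintype ι] [Fintype κ]

/-- The linear form `X ↦ tr (A X)`; every derivative below is of this form. -/
def traceMulCLM (A : Matrix κ ι ℝ) : Matrix ι κ ℝ →L[ℝ] ℝ :=
  (Matrix.traceLinearMap κ ℝ ℝ ∘ₗ mulLeftLinearMap κ ℝ A).toContinuousLinearMap

lemma traceMulCLM_apply (A : Matrix κ ι ℝ) (X : Matrix ι κ ℝ) :
    traceMulCLM A X = (A * X).trace :=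
  rfl

variable {n m : ℕ} {A S S₀ : Matrix (Fin n) (Fin n) ℝ}

lemma hasFDerivWithinAt_trace_psdSqrt (hA : A.PosDef) :
    HasFDerivWithinAt (fun S => (psdSqrt S).trace) ((2⁻¹ : ℝ) • traceMulCLM (psdSqrt A)⁻¹)
      {S | S.PosSemidef} A := by
  have hR := posDef_psdSqrt hA
  obtain ⟨C, -, hlip⟩ := exists_norm_sub_le_norm_mul_self_sub hR
  refine hasFDerivWithinAt_of_norm_sub_sub_le
    (C := 2⁻¹ * ‖(psdSqrt A)⁻¹‖ * C ^ 2) fun S hS => ?_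
  have hid := two_mul_trace_sub_trace (Q := psdSqrt S) hR.isUnit
  have hQR := hlip _ (posSemidef_psdSqrt S)
  rw [psdSqrt_mul_self hS, psdSqrt_mul_self hA.posSemidef] at hid hQR
  set D := psdSqrt S - psdSqrt A
  have hrem : (psdSqrt S).trace - (psdSqrt A).trace -
      ((2⁻¹ : ℝ) • traceMulCLM (psdSqrt A)⁻¹) (S - A) =
        -(2⁻¹ * (D * (psdSqrt A)⁻¹ * D).trace) := by
    change _ - 2⁻¹ * ((psdSqrt A)⁻¹ * (S - A)).trace = _
    linarith
  calc _ = ‖-(2⁻¹ * (D * (psdSqrt A)⁻¹ * D).trace)‖ := congrArg norm hrem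
    _ = 2⁻¹ * |(D * (psdSqrt A)⁻¹ * D).trace| := by
        rw [norm_neg, norm_mul, Real.norm_eq_abs, Real.norm_eq_abs, abs_of_pos (by norm_num)]
    _ ≤ 2⁻¹ * (‖D‖ * ‖(psdSqrt A)⁻¹‖ * ‖D‖) := by
        gcongr
        refine (abs_trace_mul_le _ _).trans ?_
        gcongr
        exact Matrix.frobenius_norm_mul _ _
    _ ≤ 2⁻¹ * (C * ‖S - A‖ * ‖(psdSqrt A)⁻¹‖ * (C * ‖S - A‖)) := by
      have := (norm_nonneg D).trans hQR
      gcongr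
    _ = _ := by ring

lemma bwSq_eq (S S₀ : Matrix (Fin n) (Fin n) ℝ) :
    bwSq S S₀ = S.trace + S₀.trace - 2 * (psdSqrt (psdSqrt S₀ * S * psdSqrt S₀)).trace := by
  rw [bwSq, Matrix.trace_sub, Matrix.trace_add, Matrix.trace_smul, smul_eq_mul]

lemma hasFDerivWithinAt_bwSq (hS₀ : S₀.PosDef) (hS : S.PosDef) :
    HasFDerivWithinAt (fun X => bwSq X S₀) (traceMulCLM (1 - transportMap S S₀))
      {X | X.PosSemidef} S := by
  let conj : Matrix (Fin n) (Fin n) ℝ →L[ℝ] Matrix (Fin n) (Fin n) ℝ :=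
    (mulRightLinearMap _ ℝ (psdSqrt S₀) ∘ₗ mulLeftLinearMap _ ℝ (psdSqrt S₀)).toContinuousLinearMap
  have hconj : Set.MapsTo conj {X | X.PosSemidef} {X | X.PosSemidef} := fun X hX =>
    posSemidef_psdSqrt_mul_mul_psdSqrt S₀ hX
  have hsqrt := (hasFDerivWithinAt_trace_psdSqrt
    (posDef_psdSqrt_mul_mul_psdSqrt hS₀ hS)).comp S conj.hasFDerivWithinAt hconj
  have htrace : HasFDerivWithinAt (fun X : Matrix (Fin n) (Fin n) ℝ => X.trace)
      (traceMulCLM 1) {X | X.PosSemidef} S :=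
    (traceMulCLM 1).hasFDerivWithinAt.congr'
      (fun X _ => by rw [traceMulCLM_apply, Matrix.one_mul]) hS.posSemidef
  have h := (htrace.add_const S₀.trace).sub (hsqrt.const_smul (2 : ℝ))
  refine (h.congr_fderiv (ContinuousLinearMap.ext fun X => ?_)).congr'
    (fun X _ => bwSq_eq X S₀) hS.posSemidef
  change (1 * X).trace - 2 * (2⁻¹ * ((psdSqrt (psdSqrt S₀ * S * psdSqrt S₀))⁻¹ *
    (psdSqrt S₀ * X * psdSqrt S₀)).trace) = ((1 - transportMap S S₀) * X).trace
  rw [mul_inv_cancel_left₀ two_ne_zero, Matrix.sub_mul, Matrix.trace_sub, transportMap,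
    ← Matrix.mul_assoc, Matrix.trace_mul_comm _ (psdSqrt S₀)]
  simp only [Matrix.mul_assoc]

lemma posDef_mul_transpose_add_smul_one {τ : ℝ} (hτ : 0 < τ) (W : Matrix (Fin n) (Fin m) ℝ) :
    (W * Wᵀ + τ • (1 : Matrix (Fin n) (Fin n) ℝ)).PosDef := by
  rw [← Matrix.conjTranspose_eq_transpose_of_trivial]
  exact .posSemidef_add (Matrix.posSemidef_self_mul_conjTranspose W) (Matrix.PosDef.one.smul hτ)

lemma hasFDerivAt_mul_transpose (W : Matrix (Fin n) (Fin m) ℝ) :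
    HasFDerivAt (fun W : Matrix (Fin n) (Fin m) ℝ => W * Wᵀ)
      (mulRightLinearMap _ ℝ Wᵀ + mulLeftLinearMap _ ℝ W ∘ₗ
        (Matrix.transposeLinearEquiv _ _ ℝ ℝ).toLinearMap).toContinuousLinearMap W := by
  refine hasFDerivWithinAt_univ.1 (hasFDerivWithinAt_of_norm_sub_sub_le (C := 1) fun X _ => ?_)
  have hrem : X * Xᵀ - W * Wᵀ - ((X - W) * Wᵀ + W * (X - W)ᵀ) = (X - W) * (X - W)ᵀ := by
    rw [Matrix.transpose_sub, Matrix.sub_mul, Matrix.sub_mul, Matrix.mul_sub, Matrix.mul_sub]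
    abel
  calc _ = ‖(X - W) * (X - W)ᵀ‖ := congrArg norm hrem
    _ ≤ ‖X - W‖ * ‖(X - W)ᵀ‖ := Matrix.frobenius_norm_mul _ _
    _ = 1 * ‖X - W‖ ^ 2 := by rw [Matrix.frobenius_norm_transpose, one_mul, sq]

theorem hasFDerivAt_smoothedLoss {τ : ℝ} (hτ : 0 < τ) (hS₀ : S₀.PosDef)
    (W : Matrix (Fin n) (Fin m) ℝ) :
    HasFDerivAt (smoothedLoss τ S₀)
      ((2 : ℝ) • traceMulCLM (Wᵀ * (1 - transportMap (W * Wᵀ + τ • 1) S₀))) W := by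
  have h := (hasFDerivWithinAt_bwSq hS₀ (posDef_mul_transpose_add_smul_one hτ W)).comp_hasFDerivAt W
    ((hasFDerivAt_mul_transpose W).add_const (τ • 1))
    (.of_forall fun X => (posDef_mul_transpose_add_smul_one hτ X).posSemidef)
  refine h.congr_fderiv (ContinuousLinearMap.ext fun H => ?_)
  have hT := transpose_transportMap (W * Wᵀ + τ • 1) S₀
  set T := transportMap (W * Wᵀ + τ • 1) S₀
  change ((1 - T) * (H * Wᵀ + W * Hᵀ)).trace = 2 * (Wᵀ * (1 - T) * H).trace
  have h₁ : ((1 - T) * (H * Wᵀ)).trace = (Wᵀ * (1 - T) * H).trace := by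
    rw [← Matrix.mul_assoc, Matrix.trace_mul_comm, Matrix.mul_assoc]
  have h₂ : ((1 - T) * (W * Hᵀ)).trace = (Wᵀ * (1 - T) * H).trace := by
    rw [← Matrix.trace_transpose, ← h₁]
    simp only [Matrix.transpose_mul, Matrix.transpose_sub, Matrix.transpose_one, hT,
      Matrix.transpose_transpose]
    exact Matrix.trace_mul_comm _ _
  rw [Matrix.mul_add, Matrix.trace_add, h₁, h₂, two_mul]

end Derivative

section Criticality

lemma hasDerivAt_add_smul {E : Type*} [NormedAddCommGroup E] [NormedSpace ℝ E] (x v : E) :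
    HasDerivAt (fun t : ℝ => x + t • v) v 0 := by
  simpa using ((hasDerivAt_id (0 : ℝ)).smul_const v).const_add x

lemma isCriticalPointOn_iff {E : Type*} [NormedAddCommGroup E] [NormedSpace ℝ E] {f : E → ℝ}
    {f' : E →L[ℝ] ℝ} {M : Set E} {x : E} (hx : x ∈ M) (hf : HasFDerivAt f f' x) :
    IsCriticalPointOn f M x ↔ ∀ v ∈ tangentVectors M x, f' v = 0 := by
  refine ⟨?_, fun h => ⟨hx, f', hf.hasFDerivWithinAt, h⟩⟩
  rintro ⟨-, g', hg, hzero⟩ v ⟨γ, ε, hε, hsmooth, hmem, rfl, hγ⟩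
  have h : HasDerivAt (f ∘ γ) (g' v) 0 :=
    (hg.comp_hasDerivWithinAt (0 : ℝ) hγ.hasDerivWithinAt hmem).hasDerivAt
      (Ioo_mem_nhds (neg_lt_zero.2 hε) hε)
  exact ((hf.comp_hasDerivAt (0 : ℝ) hγ).unique h).trans
    (hzero v ⟨γ, ε, hε, hsmooth, hmem, rfl, hγ⟩)

open scoped Matrix.Norms.Frobenius

variable {n m k : ℕ} {W : Matrix (Fin n) (Fin m) ℝ} {S₀ T : Matrix (Fin n) (Fin n) ℝ} {τ : ℝ}

lemma add_smul_mul_eq (W : Matrix (Fin n) (Fin m) ℝ) (Y : Matrix (Fin n) (Fin n) ℝ) (t : ℝ) :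
    W + t • (Y * W) = (1 + t • Y) * W := by
  rw [Matrix.add_mul, Matrix.one_mul, Matrix.smul_mul]

lemma mul_mem_tangentVectors_rankEq (hW : W ∈ rankEq n m k) (Y : Matrix (Fin n) (Fin n) ℝ) :
    Y * W ∈ tangentVectors (rankEq n m k) W := by
  have hdet : ∀ᶠ t in nhds (0 : ℝ), (1 + t • Y).det ≠ 0 := by
    have hcont : Continuous fun t : ℝ => (1 + t • Y).det := by fun_prop
    exact hcont.continuousAt.eventually_ne (by simp)
  obtain ⟨ε, hε, hball⟩ := Metric.eventually_nhds_iff_ball.1 hdet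
  refine ⟨fun t => W + t • (Y * W), ε, hε, by fun_prop, fun t ht => ?_, by simp,
    hasDerivAt_add_smul W (Y * W)⟩
  have hdet_t : (1 + t • Y).det ≠ 0 := hball t (by rw [Real.ball_eq_Ioo]; simpa using ht)
  change W + t • (Y * W) ∈ rankEq n m k
  rw [add_smul_mul_eq]
  exact (Matrix.rank_mul_eq_right_of_isUnit_det _ _ hdet_t.isUnit).trans hW

lemma transpose_mul_one_sub_eq_zero_iff (hT : Tᵀ = T) : Wᵀ * (1 - T) = 0 ↔ T * W = W := by
  rw [← Matrix.transpose_eq_zero, Matrix.transpose_mul, Matrix.transpose_sub, hT,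
    Matrix.transpose_one, Matrix.transpose_transpose, Matrix.sub_mul, Matrix.one_mul, sub_eq_zero,
    eq_comm]

lemma mul_eq_self_of_forall_trace_eq_zero (hT : Tᵀ = T)
    (h : ∀ Y : Matrix (Fin n) (Fin n) ℝ, (Wᵀ * (1 - T) * (Y * W)).trace = 0) : T * W = W := by
  have hcov : W * Wᵀ * (1 - T) = 0 := Matrix.ext_iff_trace_mul_right.2 fun Y => by
    rw [Matrix.zero_mul, Matrix.trace_zero, ← h Y, ← Matrix.mul_assoc _ Y,
      Matrix.trace_mul_comm _ W]
    simp only [Matrix.mul_assoc]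
  rw [← Matrix.conjTranspose_eq_transpose_of_trivial] at hcov
  exact (transpose_mul_one_sub_eq_zero_iff hT).1
    ((Matrix.self_mul_conjTranspose_mul_eq_zero W _).1 hcov)

theorem isCriticalOnRank_smoothedLoss_iff (hτ : 0 < τ) (hS₀ : S₀.PosDef)
    (hW : W ∈ rankEq n m k) :
    IsCriticalOnRank (smoothedLoss τ S₀) k W ↔
      transportMap (W * Wᵀ + τ • 1) S₀ * W = W := by
  have hT := transpose_transportMap (W * Wᵀ + τ • 1) S₀
  rw [IsCriticalOnRank, isCriticalPointOn_iff hW (hasFDerivAt_smoothedLoss hτ hS₀ W)]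
  refine ⟨fun h => mul_eq_self_of_forall_trace_eq_zero hT fun Y => ?_, fun h X _ => ?_⟩
  · exact (mul_eq_zero.1 (h _ (mul_mem_tangentVectors_rankEq hW Y))).resolve_left two_ne_zero
  · change 2 * (Wᵀ * (1 - transportMap (W * Wᵀ + τ • 1) S₀) * X).trace = 0
    rw [(transpose_mul_one_sub_eq_zero_iff hT).2 h, Matrix.zero_mul, Matrix.trace_zero, mul_zero]

theorem transportMap_mul_eq_of_isMinOn (hτ : 0 < τ) (hS₀ : S₀.PosDef) (hW : W ∈ rankLE n m k)
    (hmin : IsMinOn (smoothedLoss τ S₀) (rankLE n m k) W) :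
    transportMap (W * Wᵀ + τ • 1) S₀ * W = W := by
  refine mul_eq_self_of_forall_trace_eq_zero (transpose_transportMap _ _) fun Y => ?_
  have hline : HasDerivAt (fun t : ℝ => smoothedLoss τ S₀ (W + t • (Y * W)))
      (2 * (Wᵀ * (1 - transportMap (W * Wᵀ + τ • 1) S₀) * (Y * W)).trace) 0 :=
    (hasFDerivAt_smoothedLoss hτ hS₀ W).comp_hasDerivAt_of_eq (0 : ℝ)
      (hasDerivAt_add_smul W (Y * W)) (by simp)
  have hlocal : IsLocalMin (fun t : ℝ => smoothedLoss τ S₀ (W + t • (Y * W))) 0 :=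
    .of_forall fun t => by
      have ht : W + t • (Y * W) ∈ rankLE n m k := by
        rw [add_smul_mul_eq]
        exact (Matrix.rank_mul_le_right _ _).trans hW
      simpa using hmin ht
  exact (mul_eq_zero.1 (hlocal.hasDerivAt_eq_zero hline)).resolve_left two_ne_zero

end Criticality

section Spectral

section OfEigenvalues

variable {ι : Type*} [Fintype ι] [DecidableEq ι] {Ω : Matrix ι ι ℝ} {a : ι → ℝ}

/-- The symmetric matrix `Ω diag(a) Ωᵀ` with eigenvalues `a` and the columns of the orthogonal
matrix `Ω` as eigenvectors. -/
def ofEigenvalues (Ω : Matrix ι ι ℝ) (a : ι → ℝ) : Matrix ι ι ℝ :=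
  Ω * Matrix.diagonal a * Ωᵀ

lemma ofEigenvalues_mul_ofEigenvalues (hΩ : Ω ∈ Matrix.orthogonalGroup ι ℝ) (a b : ι → ℝ) :
    ofEigenvalues Ω a * ofEigenvalues Ω b = ofEigenvalues Ω (fun i => a i * b i) := by
  rw [Matrix.mem_orthogonalGroup_iff'] at hΩ
  calc ofEigenvalues Ω a * ofEigenvalues Ω b
      = Ω * Matrix.diagonal a * (Ωᵀ * Ω) * Matrix.diagonal b * Ωᵀ := by
        simp only [ofEigenvalues, Matrix.mul_assoc]
    _ = ofEigenvalues Ω (fun i => a i * b i) := by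
        rw [hΩ, Matrix.mul_one, Matrix.mul_assoc Ω, Matrix.diagonal_mul_diagonal, ofEigenvalues]

lemma ofEigenvalues_add_smul_one (hΩ : Ω ∈ Matrix.orthogonalGroup ι ℝ) (a : ι → ℝ) (c : ℝ) :
    ofEigenvalues Ω a + c • (1 : Matrix ι ι ℝ) = ofEigenvalues Ω (fun i => a i + c) := by
  rw [Matrix.mem_orthogonalGroup_iff] at hΩ
  simp only [ofEigenvalues, ← Matrix.diagonal_add, ← Matrix.smul_one_eq_diagonal, Matrix.mul_add,
    Matrix.add_mul, Matrix.mul_smul, Matrix.smul_mul, Matrix.mul_one, hΩ]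

lemma trace_ofEigenvalues (hΩ : Ω ∈ Matrix.orthogonalGroup ι ℝ) (a : ι → ℝ) :
    (ofEigenvalues Ω a).trace = ∑ i, a i := by
  rw [Matrix.mem_orthogonalGroup_iff'] at hΩ
  rw [ofEigenvalues, Matrix.trace_mul_comm, ← Matrix.mul_assoc, hΩ, Matrix.one_mul,
    Matrix.trace_diagonal]

lemma posSemidef_ofEigenvalues (Ω : Matrix ι ι ℝ) (ha : ∀ i, 0 ≤ a i) :
    (ofEigenvalues Ω a).PosSemidef :=
  (Matrix.PosSemidef.diagonal (d := a) ha).mul_mul_conjTranspose_same Ω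

lemma nonneg_of_posSemidef_ofEigenvalues (hΩ : Ω ∈ Matrix.orthogonalGroup ι ℝ)
    (h : (ofEigenvalues Ω a).PosSemidef) (i : ι) : 0 ≤ a i := by
  have hΩ' : Ωᵀ * Ω = 1 := (Matrix.mem_orthogonalGroup_iff' ι ℝ).1 hΩ
  have hdiag : Ωᴴ * ofEigenvalues Ω a * Ω = Matrix.diagonal a := by
    rw [Matrix.conjTranspose_eq_transpose_of_trivial, ofEigenvalues, Matrix.mul_assoc Ω,
      ← Matrix.mul_assoc Ωᵀ, hΩ', Matrix.one_mul, Matrix.mul_assoc, hΩ', Matrix.mul_one]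
  exact Matrix.posSemidef_diagonal_iff.1 (hdiag ▸ h.conjTranspose_mul_mul_same Ω) i

lemma posDef_ofEigenvalues (hΩ : Ω ∈ Matrix.orthogonalGroup ι ℝ) (ha : ∀ i, 0 < a i) :
    (ofEigenvalues Ω a).PosDef :=
  (Matrix.IsUnit.posDef_star_right_conjugate_iff (Unitary.isUnit_coe (U := ⟨Ω, hΩ⟩))).2
    (Matrix.PosDef.diagonal ha)

lemma inv_ofEigenvalues (hΩ : Ω ∈ Matrix.orthogonalGroup ι ℝ) (ha : ∀ i, a i ≠ 0) :
    (ofEigenvalues Ω a)⁻¹ = ofEigenvalues Ω (fun i => (a i)⁻¹) := by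
  refine Matrix.inv_eq_left_inv ?_
  rw [ofEigenvalues_mul_ofEigenvalues hΩ]
  simp only [inv_mul_cancel₀ (ha _), ofEigenvalues, Matrix.diagonal_one, Matrix.mul_one]
  exact (Matrix.mem_orthogonalGroup_iff ι ℝ).1 hΩ

lemma rank_ofEigenvalues (hΩ : Ω ∈ Matrix.orthogonalGroup ι ℝ) (a : ι → ℝ) :
    (ofEigenvalues Ω a).rank = Fintype.card {i // a i ≠ 0} := by
  have hdet : IsUnit Ω.det :=
    Matrix.isUnit_det_of_left_inverse ((Matrix.mem_orthogonalGroup_iff' ι ℝ).1 hΩ)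
  rw [ofEigenvalues, Matrix.rank_mul_eq_left_of_isUnit_det _ _ (by rwa [Matrix.det_transpose]),
    Matrix.rank_mul_eq_right_of_isUnit_det _ _ hdet, Matrix.rank_diagonal]

lemma isDiag_of_diagonal_mul_eq_mul_diagonal {R : Type*} [CommRing R] [IsDomain R] {c : ι → R}
    {P : Matrix ι ι R} (hc : Function.Injective c)
    (h : Matrix.diagonal c * P = P * Matrix.diagonal c) : P.IsDiag := by
  intro i j hij
  have hentry := congrFun (congrFun h i) j
  rw [Matrix.diagonal_mul, Matrix.mul_diagonal, mul_comm, ← sub_eq_zero, ← mul_sub] at hentry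
  exact (mul_eq_zero.1 hentry).resolve_right (sub_ne_zero.2 (hc.ne hij))

lemma exists_eq_diagonal_of_quadratic {lam : ι → ℝ} {P : Matrix ι ι ℝ} {τ : ℝ}
    (hlam : Function.Injective lam) (hPt : Pᵀ = P)
    (hP : Matrix.diagonal lam * P = P * P + τ • P) :
    ∃ d : ι → ℝ, P = Matrix.diagonal d ∧ ∀ i, d i = 0 ∨ d i = lam i - τ := by
  have hcomm : Matrix.diagonal lam * P = P * Matrix.diagonal lam := by
    have hPT := congrArg Matrix.transpose hP
    simp only [Matrix.transpose_mul, Matrix.transpose_add, Matrix.transpose_smul, hPt,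
      Matrix.diagonal_transpose] at hPT
    rw [hP, hPT]
  have hdiag := (isDiag_of_diagonal_mul_eq_mul_diagonal hlam hcomm).diagonal_diag.symm
  refine ⟨P.diag, hdiag, fun i => ?_⟩
  rw [hdiag, Matrix.diagonal_mul_diagonal, Matrix.diagonal_mul_diagonal, ← Matrix.diagonal_smul,
    Matrix.diagonal_add, Matrix.diagonal_injective.eq_iff] at hP
  have hi : lam i * P.diag i = P.diag i * P.diag i + τ * P.diag i := congrFun hP i
  have hfactor : P.diag i * (P.diag i - (lam i - τ)) = 0 := by linarith
  exact (mul_eq_zero.1 hfactor).imp_right sub_eq_zero.1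

lemma exists_eq_ofEigenvalues_of_quadratic {lam : ι → ℝ} {S : Matrix ι ι ℝ} {τ : ℝ}
    (hΩ : Ω ∈ Matrix.orthogonalGroup ι ℝ) (hlam : Function.Injective lam) (hSt : Sᵀ = S)
    (hS : ofEigenvalues Ω lam * S = S * S + τ • S) :
    ∃ d : ι → ℝ, S = ofEigenvalues Ω d ∧ ∀ i, d i = 0 ∨ d i = lam i - τ := by
  have hΩ₁ := (Matrix.mem_orthogonalGroup_iff' ι ℝ).1 hΩ
  have hΩ₂ := (Matrix.mem_orthogonalGroup_iff ι ℝ).1 hΩ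
  have hPt : (Ωᵀ * S * Ω)ᵀ = Ωᵀ * S * Ω := by
    simp only [Matrix.transpose_mul, Matrix.transpose_transpose, hSt, Matrix.mul_assoc]
  have hP : Matrix.diagonal lam * (Ωᵀ * S * Ω) = Ωᵀ * S * Ω * (Ωᵀ * S * Ω) + τ • (Ωᵀ * S * Ω) := by
    calc Matrix.diagonal lam * (Ωᵀ * S * Ω)
        = Ωᵀ * Ω * Matrix.diagonal lam * (Ωᵀ * S * Ω) := by rw [hΩ₁, Matrix.one_mul]
      _ = Ωᵀ * (ofEigenvalues Ω lam * S) * Ω := by simp only [ofEigenvalues, Matrix.mul_assoc]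
      _ = Ωᵀ * S * (Ω * Ωᵀ) * S * Ω + τ • (Ωᵀ * S * Ω) := by
        rw [hS, hΩ₂, Matrix.mul_one, Matrix.mul_add, Matrix.add_mul, Matrix.mul_smul,
          Matrix.smul_mul]
        simp only [Matrix.mul_assoc]
      _ = _ := by simp only [Matrix.mul_assoc]
  obtain ⟨d, hd, hd_eq⟩ := exists_eq_diagonal_of_quadratic hlam hPt hP
  refine ⟨d, ?_, hd_eq⟩
  calc S = Ω * Ωᵀ * S * (Ω * Ωᵀ) := by rw [hΩ₂, Matrix.one_mul, Matrix.mul_one]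
    _ = ofEigenvalues Ω d := by rw [ofEigenvalues, ← hd]; simp only [Matrix.mul_assoc]

end OfEigenvalues

variable {n m : ℕ} {Ω S₀ : Matrix (Fin n) (Fin n) ℝ} {W : Matrix (Fin n) (Fin m) ℝ}
  {a b : Fin n → ℝ} {τ : ℝ}

lemma psdSqrt_ofEigenvalues (hΩ : Ω ∈ Matrix.orthogonalGroup (Fin n) ℝ) (ha : ∀ i, 0 ≤ a i) :
    psdSqrt (ofEigenvalues Ω a) = ofEigenvalues Ω (fun i => √(a i)) :=
  psdSqrt_eq_of_mul_self (posSemidef_ofEigenvalues Ω fun i => Real.sqrt_nonneg _) <| by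
    simp only [ofEigenvalues_mul_ofEigenvalues hΩ, Real.mul_self_sqrt (ha _)]

lemma psdSqrt_mul_mul_psdSqrt_ofEigenvalues (hΩ : Ω ∈ Matrix.orthogonalGroup (Fin n) ℝ)
    (ha : ∀ i, 0 ≤ a i) (hb : ∀ i, 0 ≤ b i) :
    psdSqrt (psdSqrt (ofEigenvalues Ω b) * ofEigenvalues Ω a * psdSqrt (ofEigenvalues Ω b)) =
      ofEigenvalues Ω (fun i => √(b i) * √(a i)) := by
  have hconj : psdSqrt (ofEigenvalues Ω b) * ofEigenvalues Ω a * psdSqrt (ofEigenvalues Ω b) =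
      ofEigenvalues Ω (fun i => b i * a i) := by
    rw [psdSqrt_ofEigenvalues hΩ hb, ofEigenvalues_mul_ofEigenvalues hΩ,
      ofEigenvalues_mul_ofEigenvalues hΩ]
    congr 1
    funext i
    rw [mul_right_comm, Real.mul_self_sqrt (hb i)]
  simp only [hconj, psdSqrt_ofEigenvalues hΩ fun i => mul_nonneg (hb i) (ha i),
    Real.sqrt_mul (hb _)]

theorem bwSq_ofEigenvalues (hΩ : Ω ∈ Matrix.orthogonalGroup (Fin n) ℝ) (ha : ∀ i, 0 ≤ a i)
    (hb : ∀ i, 0 ≤ b i) :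
    bwSq (ofEigenvalues Ω a) (ofEigenvalues Ω b) = ∑ i, (√(b i) - √(a i)) ^ 2 := by
  rw [bwSq_eq, psdSqrt_mul_mul_psdSqrt_ofEigenvalues hΩ ha hb, trace_ofEigenvalues hΩ,
    trace_ofEigenvalues hΩ, trace_ofEigenvalues hΩ, Finset.mul_sum, ← Finset.sum_add_distrib,
    ← Finset.sum_sub_distrib]
  refine Finset.sum_congr rfl fun i _ => ?_
  rw [sub_sq, Real.sq_sqrt (ha i), Real.sq_sqrt (hb i)]
  ring

lemma transportMap_ofEigenvalues (hΩ : Ω ∈ Matrix.orthogonalGroup (Fin n) ℝ) (ha : ∀ i, 0 < a i)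
    (hb : ∀ i, 0 < b i) :
    transportMap (ofEigenvalues Ω a) (ofEigenvalues Ω b) =
      ofEigenvalues Ω (fun i => √(b i) / √(a i)) := by
  have hab (i : Fin n) : √(b i) * √(a i) ≠ 0 :=
    mul_ne_zero (Real.sqrt_ne_zero'.2 (hb i)) (Real.sqrt_ne_zero'.2 (ha i))
  rw [transportMap, psdSqrt_mul_mul_psdSqrt_ofEigenvalues hΩ (fun i => (ha i).le)
    fun i => (hb i).le, inv_ofEigenvalues hΩ hab, psdSqrt_ofEigenvalues hΩ fun i => (hb i).le,
    ofEigenvalues_mul_ofEigenvalues hΩ, ofEigenvalues_mul_ofEigenvalues hΩ]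
  congr 1
  funext i
  have := Real.sqrt_ne_zero'.2 (hb i)
  field_simp

lemma mul_cov_eq_of_transportMap_mul_eq (hτ : 0 < τ) (hS₀ : S₀.PosDef)
    (h : transportMap (W * Wᵀ + τ • 1) S₀ * W = W) :
    S₀ * (W * Wᵀ) = W * Wᵀ * (W * Wᵀ) + τ • (W * Wᵀ) := by
  have hTST := transportMap_mul_mul_transportMap hS₀ (posDef_mul_transpose_add_smul_one hτ W)
  set T := transportMap (W * Wᵀ + τ • 1) S₀
  calc S₀ * (W * Wᵀ) = T * (W * Wᵀ + τ • 1) * (T * W) * Wᵀ := by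
        rw [← hTST]; simp only [Matrix.mul_assoc]
    _ = T * W * (Wᵀ * (W * Wᵀ)) + τ • (T * W * Wᵀ) := by
        conv_lhs => rw [h, Matrix.mul_add, Matrix.add_mul, Matrix.add_mul, Matrix.mul_smul,
          Matrix.mul_one, Matrix.smul_mul, Matrix.smul_mul]
        simp only [Matrix.mul_assoc]
    _ = W * Wᵀ * (W * Wᵀ) + τ • (W * Wᵀ) := by rw [h, Matrix.mul_assoc W]

end Spectral

section Candidates

variable {n m k : ℕ} {Ω : Matrix (Fin n) (Fin n) ℝ} {W : Matrix (Fin n) (Fin m) ℝ}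
  {lam : Fin n → ℝ} {τ : ℝ} {J : Finset (Fin n)}

/-- The excess of the eigenvalues `lam` over `τ` on the index set `J`, extended by zero. These are
the eigenvalues of `W Wᵀ` for `W = Ω_J (Λ̄_J - τ I)^{1/2} Vᵀ`. -/
def excess (τ : ℝ) (lam : Fin n → ℝ) (J : Finset (Fin n)) (i : Fin n) : ℝ :=
  if i ∈ J then lam i - τ else 0

lemma excess_of_mem {i : Fin n} (hi : i ∈ J) : excess τ lam J i = lam i - τ :=
  if_pos hi

lemma excess_of_notMem {i : Fin n} (hi : i ∉ J) : excess τ lam J i = 0 :=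
  if_neg hi

lemma excess_nonneg (hJτ : ∀ j ∈ J, τ ≤ lam j) (i : Fin n) : 0 ≤ excess τ lam J i := by
  by_cases hi : i ∈ J
  · rw [excess_of_mem hi]
    exact sub_nonneg.2 (hJτ i hi)
  · rw [excess_of_notMem hi]

lemma rank_eq_card_of_cov_eq (hΩ : Ω ∈ Matrix.orthogonalGroup (Fin n) ℝ)
    (hJτ : ∀ j ∈ J, τ < lam j) (hW : W * Wᵀ = ofEigenvalues Ω (excess τ lam J)) :
    W.rank = J.card := by
  rw [← Matrix.rank_self_mul_transpose, hW, rank_ofEigenvalues hΩ, Fintype.card_subtype]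
  congr 1
  ext i
  simp only [Finset.mem_filter_univ]
  refine ⟨fun hi => by_contra fun hiJ => hi (excess_of_notMem hiJ), fun hi => ?_⟩
  rw [excess_of_mem hi]
  exact (sub_pos.2 (hJτ i hi)).ne'

theorem smoothedLoss_of_cov_eq (hΩ : Ω ∈ Matrix.orthogonalGroup (Fin n) ℝ)
    (hlam : ∀ i, 0 ≤ lam i) (hτ : 0 ≤ τ) (hJτ : ∀ j ∈ J, τ ≤ lam j)
    (hW : W * Wᵀ = ofEigenvalues Ω (excess τ lam J)) :
    smoothedLoss τ (ofEigenvalues Ω lam) W = ∑ j ∈ Jᶜ, (√(lam j) - √τ) ^ 2 := by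
  have hzero (j : Fin n) (hj : j ∉ Jᶜ) : (√(lam j) - √(excess τ lam J j + τ)) ^ 2 = 0 := by
    rw [excess_of_mem (by simpa using hj), sub_add_cancel, sub_self, zero_pow two_ne_zero]
  calc smoothedLoss τ (ofEigenvalues Ω lam) W
      = ∑ j, (√(lam j) - √(excess τ lam J j + τ)) ^ 2 := by
        rw [smoothedLoss, hW, ofEigenvalues_add_smul_one hΩ, bwSq_ofEigenvalues hΩ
          (fun i => add_nonneg (excess_nonneg hJτ i) hτ) hlam]
    _ = ∑ j ∈ Jᶜ, (√(lam j) - √(excess τ lam J j + τ)) ^ 2 :=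
        (Finset.sum_subset (Finset.subset_univ _) fun j _ => hzero j).symm
    _ = ∑ j ∈ Jᶜ, (√(lam j) - √τ) ^ 2 := Finset.sum_congr rfl fun j hj => by
        rw [excess_of_notMem (Finset.mem_compl.1 hj), zero_add]

theorem transportMap_mul_eq_of_cov_eq (hΩ : Ω ∈ Matrix.orthogonalGroup (Fin n) ℝ)
    (hlam : ∀ i, 0 < lam i) (hτ : 0 < τ) (hJτ : ∀ j ∈ J, τ ≤ lam j)
    (hW : W * Wᵀ = ofEigenvalues Ω (excess τ lam J)) :
    transportMap (W * Wᵀ + τ • 1) (ofEigenvalues Ω lam) * W = W := by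
  have hfixed (i : Fin n) :
      √(lam i) / √(excess τ lam J i + τ) * excess τ lam J i = excess τ lam J i := by
    by_cases hi : i ∈ J
    · rw [excess_of_mem hi, sub_add_cancel, div_self (Real.sqrt_ne_zero'.2 (hlam i)), one_mul]
    · rw [excess_of_notMem hi, mul_zero]
  have hcov : (transportMap (W * Wᵀ + τ • 1) (ofEigenvalues Ω lam) - 1) * (W * Wᴴ) = 0 := by
    rw [Matrix.conjTranspose_eq_transpose_of_trivial, sub_mul, one_mul, sub_eq_zero, hW,
      ofEigenvalues_add_smul_one hΩ, transportMap_ofEigenvalues hΩ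
        (fun i => add_pos_of_nonneg_of_pos (excess_nonneg hJτ i) hτ) hlam,
      ofEigenvalues_mul_ofEigenvalues hΩ]
    simp only [hfixed]
  rw [Matrix.mul_self_mul_conjTranspose_eq_zero, Matrix.sub_mul, Matrix.one_mul,
    sub_eq_zero] at hcov
  exact hcov

theorem exists_cov_eq_of_transportMap_mul_eq (hΩ : Ω ∈ Matrix.orthogonalGroup (Fin n) ℝ)
    (hlam : ∀ i, 0 < lam i) (hinj : Function.Injective lam) (hτ : 0 < τ)
    (h : transportMap (W * Wᵀ + τ • 1) (ofEigenvalues Ω lam) * W = W) :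
    ∃ J : Finset (Fin n), J.card = W.rank ∧ (∀ j ∈ J, τ < lam j) ∧
      W * Wᵀ = ofEigenvalues Ω (excess τ lam J) := by
  obtain ⟨d, hd, hd_eq⟩ := exists_eq_ofEigenvalues_of_quadratic hΩ hinj
    (by rw [Matrix.transpose_mul, Matrix.transpose_transpose])
    (mul_cov_eq_of_transportMap_mul_eq hτ (posDef_ofEigenvalues hΩ hlam) h)
  have hd_nonneg (i : Fin n) : 0 ≤ d i :=
    nonneg_of_posSemidef_ofEigenvalues hΩ (hd ▸ Matrix.posSemidef_self_mul_conjTranspose W) i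
  have hlt : ∀ j ∈ Finset.univ.filter (d · ≠ 0), τ < lam j := fun j hj => by
    have hj0 := (Finset.mem_filter_univ j).1 hj
    exact sub_pos.1 ((hd_eq j).resolve_left hj0 ▸ (hd_nonneg j).lt_of_ne' hj0)
  have hcov : W * Wᵀ = ofEigenvalues Ω (excess τ lam (Finset.univ.filter (d · ≠ 0))) := by
    rw [hd]
    congr 1
    funext i
    by_cases hi : d i = 0
    · rw [excess_of_notMem (by simpa using hi), hi]
    · rw [excess_of_mem (by simpa using hi), (hd_eq i).resolve_left hi]
  exact ⟨_, (rank_eq_card_of_cov_eq hΩ hlt hcov).symm, hlt, hcov⟩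

lemma principalSub_diagonal_sub_smul_one (lam : Fin n → ℝ) (τ : ℝ) (hJ : J.card = k) :
    principalSub (Matrix.diagonal lam) J hJ - τ • (1 : Matrix (Fin k) (Fin k) ℝ) =
      Matrix.diagonal fun j => lam (J.orderEmbOfFin hJ j) - τ := by
  rw [principalSub, Matrix.submatrix_diagonal _ _ (J.orderEmbOfFin hJ).injective,
    Matrix.smul_one_eq_diagonal, Matrix.diagonal_sub]
  rfl

lemma colSub_mul_diagonal_mul_transpose (Ω : Matrix (Fin n) (Fin n) ℝ) (hJ : J.card = k)
    (lam : Fin n → ℝ) (τ : ℝ) :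
    colSub Ω J hJ * (Matrix.diagonal fun j => lam (J.orderEmbOfFin hJ j) - τ) *
      (colSub Ω J hJ)ᵀ = ofEigenvalues Ω (excess τ lam J) := by
  ext i l
  rw [Matrix.mul_apply, ofEigenvalues, Matrix.mul_apply]
  simp only [Matrix.mul_diagonal, Matrix.transpose_apply, colSub, Matrix.submatrix_apply, id]
  calc ∑ j, Ω i (J.orderEmbOfFin hJ j) * (lam (J.orderEmbOfFin hJ j) - τ) *
        Ω l (J.orderEmbOfFin hJ j)
      = ∑ j ∈ J, Ω i j * (lam j - τ) * Ω l j := by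
        conv_rhs => rw [← Finset.map_orderEmbOfFin_univ J hJ, Finset.sum_map]
        rfl
    _ = ∑ j ∈ J, Ω i j * excess τ lam J j * Ω l j :=
        Finset.sum_congr rfl fun j hj => by rw [excess_of_mem hj]
    _ = ∑ j, Ω i j * excess τ lam J j * Ω l j :=
        Finset.sum_subset (Finset.subset_univ J) fun j _ hj => by
          rw [excess_of_notMem hj, mul_zero, zero_mul]

lemma colSub_mul_psdSqrt_mul_transpose (Ω : Matrix (Fin n) (Fin n) ℝ) (hJ : J.card = k)
    (hJτ : ∀ j ∈ J, τ ≤ lam j) :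
    colSub Ω J hJ * psdSqrt (principalSub (Matrix.diagonal lam) J hJ - τ • 1) *
      (colSub Ω J hJ * psdSqrt (principalSub (Matrix.diagonal lam) J hJ - τ • 1))ᵀ =
      ofEigenvalues Ω (excess τ lam J) := by
  rw [principalSub_diagonal_sub_smul_one, Matrix.transpose_mul, transpose_psdSqrt,
    Matrix.mul_assoc, ← Matrix.mul_assoc (psdSqrt _), psdSqrt_mul_self, ← Matrix.mul_assoc,
    colSub_mul_diagonal_mul_transpose]
  exact Matrix.PosSemidef.diagonal fun j =>
    sub_nonneg.2 (hJτ _ (J.orderEmbOfFin_mem hJ j))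

theorem candidate_mul_transpose (Ω : Matrix (Fin n) (Fin n) ℝ) (hJ : J.card = k)
    (hJτ : ∀ j ∈ J, τ ≤ lam j) {V : Matrix (Fin m) (Fin k) ℝ} (hV : Vᵀ * V = 1) :
    candidate τ Ω (Matrix.diagonal lam) J hJ V * (candidate τ Ω (Matrix.diagonal lam) J hJ V)ᵀ =
      ofEigenvalues Ω (excess τ lam J) := by
  rw [← colSub_mul_psdSqrt_mul_transpose Ω hJ hJτ, candidate, Matrix.transpose_mul,
    Matrix.transpose_transpose, Matrix.mul_assoc _ Vᵀ, ← Matrix.mul_assoc Vᵀ, hV, Matrix.one_mul]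

theorem exists_eq_candidate_iff (hkm : k ≤ m) (hJ : J.card = k) (hJτ : ∀ j ∈ J, τ ≤ lam j) :
    (∃ V : Matrix (Fin m) (Fin k) ℝ, Vᵀ * V = 1 ∧ W = candidate τ Ω (Matrix.diagonal lam) J hJ V) ↔
      W * Wᵀ = ofEigenvalues Ω (excess τ lam J) := by
  refine ⟨?_, fun hW => ?_⟩
  · rintro ⟨V, hV, rfl⟩
    exact candidate_mul_transpose Ω hJ hJτ hV
  · exact exists_eq_mul_conjTranspose (Fin.castLEEmb hkm)
      (hW.trans (colSub_mul_psdSqrt_mul_transpose Ω hJ hJτ).symm)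

end Candidates

section Existence

open scoped Matrix.Norms.Frobenius

variable {n m : ℕ} {S S₀ : Matrix (Fin n) (Fin n) ℝ} {τ : ℝ}

lemma isClosed_rankLE (n m k : ℕ) : IsClosed (rankLE n m k) := by
  let toCLM : Matrix (Fin n) (Fin m) ℝ →ₗ[ℝ] ((Fin m → ℝ) →L[ℝ] (Fin n → ℝ)) :=
    LinearMap.toContinuousLinearMap.toLinearMap ∘ₗ Matrix.toLin'.toLinearMap
  have hopen : IsOpen {W | ((k + 1 : ℕ) : Cardinal) ≤ (toCLM W).toLinearMap.rank} :=
    (isOpen_setOfPred_nat_le_rank (k + 1)).preimage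
      (LinearMap.continuous_of_finiteDimensional toCLM)
  have hrank (W : Matrix (Fin n) (Fin m) ℝ) : (toCLM W).toLinearMap.rank = W.rank :=
    (Module.finrank_eq_rank ℝ (LinearMap.range (Matrix.mulVecLin W))).symm
  rw [← isOpen_compl_iff]
  convert hopen using 1
  ext W
  simp only [hrank, Nat.cast_le, Nat.succ_le_iff]
  exact not_le (a := W.rank) (b := k)

lemma trace_inv_mul_psdSqrt_mul_mul_psdSqrt (hS₀ : S₀.PosDef) (S : Matrix (Fin n) (Fin n) ℝ) :
    (S₀⁻¹ * (psdSqrt S₀ * S * psdSqrt S₀)).trace = S.trace := by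
  have hu := (Matrix.isUnit_iff_isUnit_det _).1 (posDef_psdSqrt hS₀).isUnit
  nth_rw 1 [← psdSqrt_mul_self hS₀.posSemidef]
  rw [Matrix.mul_inv_rev, Matrix.mul_assoc, Matrix.mul_assoc (psdSqrt S₀),
    Matrix.nonsing_inv_mul_cancel_left _ _ hu, Matrix.trace_mul_comm,
    Matrix.mul_nonsing_inv_cancel_right _ _ hu]

lemma half_trace_sub_trace_le_bwSq (hS₀ : S₀.PosDef) (hS : S.PosSemidef) :
    S.trace / 2 - S₀.trace ≤ bwSq S S₀ := by
  set Q := psdSqrt (psdSqrt S₀ * S * psdSqrt S₀) with hQdef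
  have hdet : IsUnit S₀.det := (Matrix.isUnit_iff_isUnit_det _).1 hS₀.isUnit
  have hinv : ((2 : ℝ) • S₀)⁻¹ = (1 / 2 : ℝ) • S₀⁻¹ := by
    refine Matrix.inv_eq_left_inv ?_
    rw [Matrix.smul_mul, Matrix.mul_smul, smul_smul, Matrix.nonsing_inv_mul _ hdet]
    norm_num
  have hbound := calc 2 * (Q.trace - ((2 : ℝ) • S₀).trace)
      ≤ (((2 : ℝ) • S₀)⁻¹ * (Q * Q - (2 : ℝ) • S₀ * (2 : ℝ) • S₀)).trace :=
        two_mul_trace_sub_trace_le (posSemidef_psdSqrt _).isHermitian (hS₀.smul two_pos)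
    _ = S.trace / 2 - 2 * S₀.trace := by
        rw [psdSqrt_mul_self (posSemidef_psdSqrt_mul_mul_psdSqrt S₀ hS), hinv, Matrix.smul_mul,
          Matrix.mul_sub, smul_sub, Matrix.trace_sub, Matrix.trace_smul,
          trace_inv_mul_psdSqrt_mul_mul_psdSqrt hS₀, Matrix.smul_mul, Matrix.mul_smul,
          Matrix.mul_smul, Matrix.mul_smul, Matrix.nonsing_inv_mul_cancel_left _ _ hdet,
          Matrix.trace_smul, Matrix.trace_smul, Matrix.trace_smul]
        simp only [smul_eq_mul]
        ring
  rw [Matrix.trace_smul, smul_eq_mul] at hbound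
  rw [bwSq_eq, ← hQdef]
  linarith

lemma half_norm_sq_sub_trace_le_smoothedLoss (hτ : 0 ≤ τ) (hS₀ : S₀.PosDef)
    (W : Matrix (Fin n) (Fin m) ℝ) : ‖W‖ ^ 2 / 2 - S₀.trace ≤ smoothedLoss τ S₀ W := by
  have hsmul : (τ • (1 : Matrix (Fin n) (Fin n) ℝ)).PosSemidef := Matrix.PosSemidef.one.smul hτ
  have hcov : (W * Wᵀ + τ • 1).PosSemidef :=
    (Matrix.posSemidef_self_mul_conjTranspose W).add hsmul
  refine le_trans ?_ (half_trace_sub_trace_le_bwSq hS₀ hcov)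
  rw [Matrix.trace_add, frobenius_norm_sq]
  linarith [hsmul.trace_nonneg]

lemma continuous_smoothedLoss (hτ : 0 < τ) (hS₀ : S₀.PosDef) :
    Continuous (smoothedLoss (m := m) τ S₀) :=
  continuous_iff_continuousAt.2 fun W => (hasFDerivAt_smoothedLoss hτ hS₀ W).continuousAt

theorem exists_isMinOn_rankLE (hτ : 0 < τ) (hS₀ : S₀.PosDef) (m k : ℕ) :
    ∃ W ∈ rankLE n m k, IsMinOn (smoothedLoss τ S₀) (rankLE n m k) W := by
  have hzero : (0 : Matrix (Fin n) (Fin m) ℝ) ∈ rankLE n m k := by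
    simp only [rankLE, Set.mem_ofPred_eq, Matrix.rank_zero, zero_le]
  have hcoercive : Filter.Tendsto (fun W : Matrix (Fin n) (Fin m) ℝ => ‖W‖ ^ 2 / 2 - S₀.trace)
      (Filter.cocompact _) Filter.atTop :=
    Filter.tendsto_atTop_add_const_right _ _ <| Filter.Tendsto.atTop_div_const two_pos <|
      (Filter.tendsto_pow_atTop two_ne_zero).comp
        (tendsto_norm_cocompact_atTop (E := Matrix (Fin n) (Fin m) ℝ))
  refine (continuous_smoothedLoss hτ hS₀).continuousOn.exists_isMinOn' (isClosed_rankLE n m k)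
    hzero (Filter.Eventually.filter_mono inf_le_left ?_)
  filter_upwards [hcoercive.eventually_ge_atTop (smoothedLoss τ S₀ 0)] with W hW
  exact hW.trans (half_norm_sq_sub_trace_le_smoothedLoss hτ.le hS₀ W)

end Existence

section Main

variable {n m k : ℕ} {Ω : Matrix (Fin n) (Fin n) ℝ} {W : Matrix (Fin n) (Fin m) ℝ}
  {lam : Fin n → ℝ} {τ : ℝ}

lemma mem_firstIndices {i : Fin n} : i ∈ firstIndices n k ↔ (i : ℕ) < k :=
  Finset.mem_filter_univ i

lemma sq_sqrt_sub_sqrt_lt {x y : ℝ} (hτ : 0 ≤ τ) (hy : τ ≤ y) (hxy : y < x) :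
    (√y - √τ) ^ 2 < (√x - √τ) ^ 2 :=
  pow_lt_pow_left₀ (sub_lt_sub_right (Real.sqrt_lt_sqrt (hτ.trans hy) hxy) _)
    (sub_nonneg.2 (Real.sqrt_le_sqrt hy)) two_ne_zero

lemma excess_eq_of_sum_le (hkn : k ≤ n) (hanti : StrictAnti lam) (hτ : 0 ≤ τ)
    (hk : ∀ i : Fin n, (i : ℕ) < k → τ ≤ lam i) {J : Finset (Fin n)} (hJ : J.card ≤ k)
    (hJτ : ∀ j ∈ J, τ ≤ lam j)
    (hle : ∑ j ∈ Jᶜ, (√(lam j) - √τ) ^ 2 ≤ ∑ j ∈ (firstIndices n k)ᶜ, (√(lam j) - √τ) ^ 2) :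
    excess τ lam J = excess τ lam (firstIndices n k) := by
  have hgap (j : Fin n) : 0 ≤ (√(lam j) - √τ) ^ 2 := sq_nonneg _
  have hle' : ∑ j ∈ firstIndices n k, (√(lam j) - √τ) ^ 2 ≤ ∑ j ∈ J, (√(lam j) - √τ) ^ 2 := by
    linarith [Finset.sum_add_sum_compl J fun j => (√(lam j) - √τ) ^ 2,
      Finset.sum_add_sum_compl (firstIndices n k) fun j => (√(lam j) - √τ) ^ 2]
  have hsub : J ⊆ firstIndices n k := by
    refine subset_of_sum_le_sum hgap (hJ.trans_eq (card_firstIndices hkn).symm) ?_ hle'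
    intro j hjJ hj i hi _
    rw [mem_firstIndices] at hi hj
    exact sq_sqrt_sub_sqrt_lt hτ (hJτ j hjJ) (hanti (Fin.lt_def.2 (hi.trans_le (not_lt.1 hj))))
  funext i
  by_cases hiJ : i ∈ J
  · rw [excess_of_mem hiJ, excess_of_mem (hsub hiJ)]
  -- Leaving out an index with `lam i = τ` is free: `J` may be smaller, its excess is the same.
  by_cases hi : i ∈ firstIndices n k
  · have hgap_zero := eq_zero_of_subset_of_sum_le_sum hgap hsub hle' hi hiJ
    have hτi := hk i (mem_firstIndices.1 hi)
    have hsqrt : √(lam i) = √τ := sub_eq_zero.1 (pow_eq_zero_iff two_ne_zero |>.1 hgap_zero)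
    rw [excess_of_notMem hiJ, excess_of_mem hi, (Real.sqrt_inj (hτ.trans hτi) hτ).1 hsqrt, sub_self]
  · rw [excess_of_notMem hiJ, excess_of_notMem hi]

theorem isCriticalOnRank_smoothedLoss_iff_exists_candidate (hkm : k ≤ m)
    (hΩ : Ω ∈ Matrix.orthogonalGroup (Fin n) ℝ) (hlam : ∀ i, 0 < lam i)
    (hinj : Function.Injective lam) (hτ : 0 < τ) (hW : W ∈ rankEq n m k) :
    IsCriticalOnRank (smoothedLoss τ (ofEigenvalues Ω lam)) k W ↔
      ∃ (J : Finset (Fin n)) (hJ : J.card = k) (V : Matrix (Fin m) (Fin k) ℝ),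
        (∀ j ∈ J, τ ≤ lam j) ∧ Vᵀ * V = 1 ∧ W = candidate τ Ω (Matrix.diagonal lam) J hJ V := by
  rw [isCriticalOnRank_smoothedLoss_iff hτ (posDef_ofEigenvalues hΩ hlam) hW]
  constructor
  · intro h
    obtain ⟨J, hJ, hJτ, hcov⟩ := exists_cov_eq_of_transportMap_mul_eq hΩ hlam hinj hτ h
    have hJτ' : ∀ j ∈ J, τ ≤ lam j := fun j hj => (hJτ j hj).le
    obtain ⟨V, hV, hWV⟩ := (exists_eq_candidate_iff hkm (hJ.trans hW) hJτ').2 hcov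
    exact ⟨J, hJ.trans hW, V, hJτ', hV, hWV⟩
  · rintro ⟨J, hJ, V, hJτ, hV, rfl⟩
    exact transportMap_mul_eq_of_cov_eq hΩ hlam hτ hJτ (candidate_mul_transpose Ω hJ hJτ hV)

theorem smoothedLoss_candidate (hΩ : Ω ∈ Matrix.orthogonalGroup (Fin n) ℝ)
    (hlam : ∀ i, 0 ≤ lam i) (hτ : 0 ≤ τ) {J : Finset (Fin n)} (hJ : J.card = k)
    (hJτ : ∀ j ∈ J, τ ≤ lam j) {V : Matrix (Fin m) (Fin k) ℝ} (hV : Vᵀ * V = 1) :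
    smoothedLoss τ (ofEigenvalues Ω lam) (candidate τ Ω (Matrix.diagonal lam) J hJ V) =
      ∑ j ∈ Jᶜ, (√(lam j) - √τ) ^ 2 :=
  smoothedLoss_of_cov_eq hΩ hlam hτ hJτ (candidate_mul_transpose Ω hJ hJτ hV)

lemma candidate_mem_rankLE (τ : ℝ) (Ω Λ : Matrix (Fin n) (Fin n) ℝ) {J : Finset (Fin n)}
    (hJ : J.card = k) (V : Matrix (Fin m) (Fin k) ℝ) : candidate τ Ω Λ J hJ V ∈ rankLE n m k :=
  (Matrix.rank_mul_le_right _ _).trans (Matrix.rank_le_height _)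

lemma candidate_mem_rankEq (hΩ : Ω ∈ Matrix.orthogonalGroup (Fin n) ℝ) {J : Finset (Fin n)}
    (hJ : J.card = k) (hJτ : ∀ j ∈ J, τ < lam j) {V : Matrix (Fin m) (Fin k) ℝ}
    (hV : Vᵀ * V = 1) : candidate τ Ω (Matrix.diagonal lam) J hJ V ∈ rankEq n m k :=
  (rank_eq_card_of_cov_eq hΩ hJτ
    (candidate_mul_transpose Ω hJ (fun j hj => (hJτ j hj).le) hV)).trans hJ

lemma exists_transpose_mul_self_eq_one (hkm : k ≤ m) :
    ∃ V : Matrix (Fin m) (Fin k) ℝ, Vᵀ * V = 1 :=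
  ⟨_, conjTranspose_mul_self_one_submatrix (Fin.castLEEmb hkm)⟩

theorem cov_eq_of_isMinOn (hkn : k ≤ n) (hkm : k ≤ m) (hΩ : Ω ∈ Matrix.orthogonalGroup (Fin n) ℝ)
    (hlam : ∀ i, 0 < lam i) (hanti : StrictAnti lam) (hτ : 0 < τ)
    (hk : ∀ i : Fin n, (i : ℕ) < k → τ ≤ lam i) (hW : W ∈ rankLE n m k)
    (hmin : IsMinOn (smoothedLoss τ (ofEigenvalues Ω lam)) (rankLE n m k) W) :
    W * Wᵀ = ofEigenvalues Ω (excess τ lam (firstIndices n k)) := by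
  obtain ⟨J, hJ, hJτ, hcov⟩ := exists_cov_eq_of_transportMap_mul_eq hΩ hlam hanti.injective hτ
    (transportMap_mul_eq_of_isMinOn hτ (posDef_ofEigenvalues hΩ hlam) hW hmin)
  have hJτ' : ∀ j ∈ J, τ ≤ lam j := fun j hj => (hJτ j hj).le
  obtain ⟨V, hV⟩ := exists_transpose_mul_self_eq_one hkm
  have hle := calc ∑ j ∈ Jᶜ, (√(lam j) - √τ) ^ 2
      = smoothedLoss τ (ofEigenvalues Ω lam) W :=
        (smoothedLoss_of_cov_eq hΩ (fun i => (hlam i).le) hτ.le hJτ' hcov).symm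
    _ ≤ smoothedLoss τ (ofEigenvalues Ω lam)
          (candidate τ Ω (Matrix.diagonal lam) (firstIndices n k) (card_firstIndices hkn) V) :=
        hmin (candidate_mem_rankLE τ Ω _ _ V)
    _ = ∑ j ∈ (firstIndices n k)ᶜ, (√(lam j) - √τ) ^ 2 :=
        smoothedLoss_candidate hΩ (fun i => (hlam i).le) hτ.le _
          (fun j hj => hk j (mem_firstIndices.1 hj)) hV
  rw [hcov, excess_eq_of_sum_le hkn hanti hτ.le hk (hJ.trans_le hW) hJτ' hle]

theorem isLeast_smoothedLoss_rankLE (hkn : k ≤ n) (hkm : k ≤ m)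
    (hΩ : Ω ∈ Matrix.orthogonalGroup (Fin n) ℝ) (hlam : ∀ i, 0 < lam i) (hanti : StrictAnti lam)
    (hτ : 0 < τ) (hk : ∀ i : Fin n, (i : ℕ) < k → τ ≤ lam i) :
    IsLeast (smoothedLoss τ (ofEigenvalues Ω lam) '' rankLE n m k)
      (∑ j ∈ (firstIndices n k)ᶜ, (√(lam j) - √τ) ^ 2) := by
  obtain ⟨W, hW, hmin⟩ := exists_isMinOn_rankLE hτ (posDef_ofEigenvalues hΩ hlam) m k
  rw [← smoothedLoss_of_cov_eq hΩ (fun i => (hlam i).le) hτ.le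
    (fun j hj => hk j (mem_firstIndices.1 hj))
    (cov_eq_of_isMinOn hkn hkm hΩ hlam hanti hτ hk hW hmin)]
  exact ⟨Set.mem_image_of_mem _ hW, Set.forall_mem_image.2 hmin⟩

theorem isMinOn_smoothedLoss_rankLE_iff (hkn : k ≤ n) (hkm : k ≤ m)
    (hΩ : Ω ∈ Matrix.orthogonalGroup (Fin n) ℝ) (hlam : ∀ i, 0 < lam i) (hanti : StrictAnti lam)
    (hτ : 0 < τ) (hk : ∀ i : Fin n, (i : ℕ) < k → τ ≤ lam i) (hW : W ∈ rankLE n m k) :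
    IsMinOn (smoothedLoss τ (ofEigenvalues Ω lam)) (rankLE n m k) W ↔
      ∃ V : Matrix (Fin m) (Fin k) ℝ, Vᵀ * V = 1 ∧
        W = candidate τ Ω (Matrix.diagonal lam) (firstIndices n k) (card_firstIndices hkn) V := by
  have hK : ∀ j ∈ firstIndices n k, τ ≤ lam j := fun j hj => hk j (mem_firstIndices.1 hj)
  rw [exists_eq_candidate_iff hkm _ hK]
  refine ⟨cov_eq_of_isMinOn hkn hkm hΩ hlam hanti hτ hk hW, fun hcov X hX => ?_⟩
  rw [Set.mem_ofPred_eq, smoothedLoss_of_cov_eq hΩ (fun i => (hlam i).le) hτ.le hK hcov]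
  exact (isLeast_smoothedLoss_rankLE hkn hkm hΩ hlam hanti hτ hk).2 (Set.mem_image_of_mem _ hX)

theorem isLeast_smoothedLoss_rankEq (hkn : k ≤ n) (hkm : k ≤ m)
    (hΩ : Ω ∈ Matrix.orthogonalGroup (Fin n) ℝ) (hlam : ∀ i, 0 < lam i) (hanti : StrictAnti lam)
    (hτ : 0 < τ) (hk : ∀ i : Fin n, (i : ℕ) < k → τ < lam i) :
    IsLeast (smoothedLoss τ (ofEigenvalues Ω lam) '' rankEq n m k)
      (∑ j ∈ (firstIndices n k)ᶜ, (√(lam j) - √τ) ^ 2) := by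
  have hK : ∀ j ∈ firstIndices n k, τ < lam j := fun j hj => hk j (mem_firstIndices.1 hj)
  obtain ⟨V, hV⟩ := exists_transpose_mul_self_eq_one hkm
  refine ⟨⟨_, candidate_mem_rankEq hΩ (card_firstIndices hkn) hK hV,
    smoothedLoss_candidate hΩ (fun i => (hlam i).le) hτ.le _ (fun j hj => (hK j hj).le) hV⟩, ?_⟩
  refine lowerBounds_mono_set (Set.image_mono fun X hX => ?_)
    (isLeast_smoothedLoss_rankLE hkn hkm hΩ hlam hanti hτ fun i hi => (hk i hi).le).2
  exact hX.le

end Main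

end BuresWasserstein

end

theorem mainTheorem2 {n m k : ℕ} (hkn : k ≤ n) (hkm : k ≤ m)
    (S₀ Ω : Matrix (Fin n) (Fin n) ℝ) (lam : Fin n → ℝ)
    (hΩ : Ω ∈ Matrix.orthogonalGroup (Fin n) ℝ)
    (hS₀ : S₀ = Ω * Matrix.diagonal lam * Ωᵀ)
    (hpos : ∀ i, 0 < lam i) (hanti : StrictAnti lam)
    (τ : ℝ) (hτ : 0 < τ) :
    -- the critical points of the smoothed loss on the rank-`k` manifold
    (∀ W ∈ BuresWasserstein.rankEq n m k,
      BuresWasserstein.IsCriticalOnRank (BuresWasserstein.smoothedLoss τ S₀) k W ↔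
        ∃ (J : Finset (Fin n)) (hJ : J.card = k) (V : Matrix (Fin m) (Fin k) ℝ),
          (∀ j ∈ J, τ ≤ lam j) ∧ Vᵀ * V = 1 ∧
            W = BuresWasserstein.candidate τ Ω (Matrix.diagonal lam) J hJ V) ∧
    -- the value of the loss at these points
    (∀ (J : Finset (Fin n)) (hJ : J.card = k) (V : Matrix (Fin m) (Fin k) ℝ),
      (∀ j ∈ J, τ ≤ lam j) → Vᵀ * V = 1 →
        BuresWasserstein.smoothedLoss τ S₀
            (BuresWasserstein.candidate τ Ω (Matrix.diagonal lam) J hJ V) =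
          ∑ j ∈ Jᶜ, (√(lam j) - √τ) ^ 2) ∧
    -- the minimum over rank at most `k`, and the minimizers
    ((∀ i : Fin n, (i : ℕ) < k → τ ≤ lam i) →
      IsLeast (BuresWasserstein.smoothedLoss τ S₀ '' BuresWasserstein.rankLE n m k)
        (∑ j ∈ (BuresWasserstein.firstIndices n k)ᶜ, (√(lam j) - √τ) ^ 2) ∧
      ∀ W ∈ BuresWasserstein.rankLE n m k,
        IsMinOn (BuresWasserstein.smoothedLoss τ S₀) (BuresWasserstein.rankLE n m k) W ↔
          ∃ V : Matrix (Fin m) (Fin k) ℝ, Vᵀ * V = 1 ∧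
            W = BuresWasserstein.candidate τ Ω (Matrix.diagonal lam)
              (BuresWasserstein.firstIndices n k) (BuresWasserstein.card_firstIndices hkn) V) ∧
    -- the infimum over rank exactly `k` is attained and equals the minimum over rank at most `k`
    ((∀ i : Fin n, (i : ℕ) < k → τ < lam i) →
      ∃ μ : ℝ,
        IsLeast (BuresWasserstein.smoothedLoss τ S₀ '' BuresWasserstein.rankEq n m k) μ ∧
        IsLeast (BuresWasserstein.smoothedLoss τ S₀ '' BuresWasserstein.rankLE n m k) μ) := by
  obtain rfl : S₀ = BuresWasserstein.ofEigenvalues Ω lam := hS₀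
  refine ⟨fun W hW => ?_, fun J hJ V hJτ hV => ?_, fun hk => ⟨?_, fun W hW => ?_⟩,
    fun hk => ?_⟩
  · exact BuresWasserstein.isCriticalOnRank_smoothedLoss_iff_exists_candidate hkm hΩ hpos
      hanti.injective hτ hW
  · exact BuresWasserstein.smoothedLoss_candidate hΩ (fun i => (hpos i).le) hτ.le hJ hJτ hV
  · exact BuresWasserstein.isLeast_smoothedLoss_rankLE hkn hkm hΩ hpos hanti hτ hk
  · exact BuresWasserstein.isMinOn_smoothedLoss_rankLE_iff hkn hkm hΩ hpos hanti hτ hk hW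
  · exact ⟨_, BuresWasserstein.isLeast_smoothedLoss_rankEq hkn hkm hΩ hpos hanti hτ hk,
      BuresWasserstein.isLeast_smoothedLoss_rankLE hkn hkm hΩ hpos hanti hτ
        fun i hi => (hk i hi).le⟩
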